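/- **Setting.** All curves are smooth and regular in $\mathbb R^3$, primes denote derivatives with respect to arclength $s$, and $T$ is the unit tangent. A *(generalized) Frenet frame* along a curve is a smooth positively oriented orthonormal frame $(T,N,B)$ with $T'=\kappa N$, $N'=-\kappa T+\tau B$, $B'=-\tau N$ for smooth functions $\kappa,\tau$; on a closed curve $N$ is required to close up to sign. If the curve has no inflection points we take $\kappa>0$; in general $\kappa$ may vanish and change sign. Curves are either closed and varied through closed curves, or arcs varied with endpoints fixed to second order (and with the normal line $\pm N$ at the endpoints fixed, which is automatic where $\kappa\ne0$). All varied curves are assumed to possess a (generalized) Frenet frame, and varied curves of a curve regarded as free of inflection points are themselves free of inflection points. When inflection points are allowed, $\int\tau\,ds$ can jump by multiples of $\pi$ along a smooth variation and is therefore considered modulo $\pi$; derivatives are those of a continuous branch. For constants $\lambda_1,\lambda_2,\lambda_3$ with $\lambda_3\neq0$, a curve $\gamma$ is *critical* for $$\mathcal F=\lambda_1\int ds+\lambda_2\int\tau\,ds+\lambda_3\int\kappa^2\,ds$$ if the derivative of $\mathcal F$ along every smooth one-parameter variation of $\gamma$ of the above kind vanishes. A *rod* is a curve (its *centerline*) with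 a smooth positively oriented orthonormal frame $(M_1,M_2,T)$ along it, the material frame, which need not close up on a closed curve; its strains $u_1,u_2,u_3$ are given by $$T'=u_2M_1-u_1M_2,\qquad M_1'=-u_2T+u_3M_2,\qquad M_2'=u_1T-u_3M_1,$$ and $u_3$ is its *twist rate*. Its energy is $$\mathcal E=\int\alpha(u_1^2+u_2^2)+\beta u_3^2\,ds=\int\alpha\kappa^2+\beta u_3^2\,ds .$$ If $(T,N,B)$ is a (generalized) Frenet frame of the centerline and $M_1=N\cos\psi+B\sin\psi$ with $\psi$ smooth, then $\Delta\psi$ denotes the total change of $\psi$ along the rod. It satisfies the balance equation $$\int u_3\,ds=\Delta\psi+\int\tau\,ds .$$ **Theorem.** Let $\alpha,\beta>0$, and let $\gamma$ be a curve (closed, or an arc) possessing a (generalized) Frenet frame, which is critical for $\mathcal F$ for some constants $\lambda_1,\lambda_2,\lambda_3$ with $\lambda_3\ne0$. There is a unique real number $m$ with $\alpha:2\beta m=\lambda_3:\lambda_2$, that is, $\alpha\lambda_2=2\beta m\lambda_3$. For this $m$ there is a rod with centerline $\gamma$ and constant twist rate $u_3\equiv m$ which is an equilibrium of $\mathcal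 E$ among rods of the same length that have the same prescribed value of $\Delta\psi$: the derivative of $\mathcal E$ vanishes along every smooth variation of the rod that preserves the total length and $\Delta\psi$ and whose centerlines vary as above. The prescribed value of $\Delta\psi$ is determined by the balance equation, i.e. $\Delta\psi=m\int_\gamma ds-\int_\gamma\tau\,ds$. If $\gamma$ and the varied centerlines have no inflection points, $\Delta\psi$ is prescribed as a real number; if inflection points are allowed, it is prescribed modulo $\pi$. -/

import Mathlib

open Set
open scoped ContDiff RealInnerProductSpace

noncomputable section

namespace ElasticRod

/-- Euclidean three-space. -/
abbrev E3 : Type := EuclideanSpace ℝ (Fin 3)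

/-- The cross product of `ℝ³`. -/
def cross (x y : E3) : E3 :=
  WithLp.toLp 2 (crossProduct (WithLp.ofLp x) (WithLp.ofLp y))

/-! ### Parametrised curves

A curve is a regular smooth map `ℝ → ℝ³`; the curve that is meant is its part over the parameter
interval `[0, 1]`. The parameter is arbitrary, and all geometric quantities are taken with respect
to arclength `ds = ‖c'(t)‖ dt`. -/

/-- The speed `ds/dt`. -/
def speed (c : ℝ → E3) (t : ℝ) : ℝ := ‖deriv c t‖

/-- The derivative `df/ds` of a vector field along `c` with respect to the arclength of `c`. -/
def arcDeriv (c f : ℝ → E3) (t : ℝ) : E3 := (speed c t)⁻¹ • deriv f t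

/-- The unit tangent `T = dc/ds`. -/
def tangent (c : ℝ → E3) : ℝ → E3 := arcDeriv c c

/-- The integral `∫ f ds` along the curve. -/
def arcIntegral (c : ℝ → E3) (f : ℝ → ℝ) : ℝ := ∫ t in (0 : ℝ)..1, f t * speed c t

/-- The length of the curve. -/
def length (c : ℝ → E3) : ℝ := arcIntegral c fun _ => 1

/-- The two kinds of boundary conditions for centerlines: closed curves, and arcs whose endpoints
are kept fixed to second order. -/
inductive Ends
  | closed
  | clamped

/-- Regular smooth curves; for `Ends.closed` they are closed (of period `1` in the parameter). -/
structure IsCurve (e : Ends) (c : ℝ → E3) : Prop where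
  smooth : ContDiff ℝ ∞ c
  regular : ∀ t, deriv c t ≠ 0
  closed : e = Ends.closed → ∀ t, c (t + 1) = c t

/-- Smooth one-parameter variations `c ε` of the curve `γ`, through closed curves or through arcs
whose endpoints are fixed to second order. -/
structure IsVariation (e : Ends) (γ : ℝ → E3) (c : ℝ → ℝ → E3) : Prop where
  smooth : ContDiff ℝ ∞ fun p : ℝ × ℝ => c p.1 p.2
  start : c 0 = γ
  curve : ∀ ε, IsCurve e (c ε)
  clamped : e = Ends.clamped → ∀ ε, ∀ k ≤ 2,
    iteratedDeriv k (c ε) 0 = iteratedDeriv k γ 0 ∧ iteratedDeriv k (c ε) 1 = iteratedDeriv k γ 1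

/-! ### Frenet frames -/

/-- A smooth generalized Frenet frame along `c` (over `[0, 1]`): a positively oriented orthonormal
frame `T, N, B` that satisfies the Frenet equations with smooth coefficients `κ` and `τ`. Here `κ`
may vanish and change its sign. -/
structure FrenetFrame (c : ℝ → E3) where
  N : ℝ → E3
  B : ℝ → E3
  κ : ℝ → ℝ
  τ : ℝ → ℝ
  smooth_N : ContDiff ℝ ∞ N
  smooth_B : ContDiff ℝ ∞ B
  smooth_κ : ContDiff ℝ ∞ κ
  smooth_τ : ContDiff ℝ ∞ τ
  norm_N : ∀ t ∈ Icc (0 : ℝ) 1, ‖N t‖ = 1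
  inner_N : ∀ t ∈ Icc (0 : ℝ) 1, ⟪tangent c t, N t⟫ = 0
  B_eq : ∀ t ∈ Icc (0 : ℝ) 1, B t = cross (tangent c t) (N t)
  frenet_T : ∀ t ∈ Icc (0 : ℝ) 1, arcDeriv c (tangent c) t = κ t • N t
  frenet_N : ∀ t ∈ Icc (0 : ℝ) 1, arcDeriv c N t = -(κ t) • tangent c t + τ t • B t
  frenet_B : ∀ t ∈ Icc (0 : ℝ) 1, arcDeriv c B t = -(τ t) • N t

/-- The total torsion `∫ τ ds`. -/
def FrenetFrame.totalTorsion {c : ℝ → E3} (F : FrenetFrame c) : ℝ := arcIntegral c F.τ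

/-- The total squared curvature `∫ κ² ds`. -/
def FrenetFrame.bending {c : ℝ → E3} (F : FrenetFrame c) : ℝ := arcIntegral c fun t => F.κ t ^ 2

/-- Whether one works with curves without inflection points (and their Frenet frames), or with
curves that may have inflection points (and generalized Frenet frames). -/
inductive Inflections
  | none
  | allowed

/-- Total torsion and total twist relative to the Frenet frame are real numbers as long as there
are no inflection points, and are considered modulo `π` when inflection points are allowed. -/
def Inflections.period : Inflections → ℝ
  | .none => 0
  | .allowed => Real.pi

/-- The (generalized) Frenet frames in use. On a closed curve the frame closes up, up to the sign
of `N`; on an arc the line of the normal at the two endpoints is that of the reference frame `F₀`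
(which is automatic at an endpoint of non-zero curvature that is fixed to second order). Without
inflection points, `κ > 0`. -/
structure FrenetFrame.Admissible {γ c : ℝ → E3} (e : Ends) (i : Inflections)
    (F₀ : FrenetFrame γ) (F : FrenetFrame c) : Prop where
  closed : e = Ends.closed → (∀ t, F.N (t + 1) = F.N t) ∨ (∀ t, F.N (t + 1) = -F.N t)
  clamped : e = Ends.clamped →
    (F.N 0 = F₀.N 0 ∨ F.N 0 = -F₀.N 0) ∧ (F.N 1 = F₀.N 1 ∨ F.N 1 = -F₀.N 1)
  pos : i = Inflections.none → ∀ t ∈ Icc (0 : ℝ) 1, 0 < F.κ t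

/-- The geometric functional `λ₁ ∫ ds + λ₂ ∫ τ ds + λ₃ ∫ κ² ds`. -/
def geometricFunctional (l₁ l₂ l₃ : ℝ) {c : ℝ → E3} (F : FrenetFrame c) : ℝ :=
  l₁ * length c + l₂ * F.totalTorsion + l₃ * F.bending

/-- `γ` is critical for the geometric functional: its derivative vanishes along every variation.
Without inflection points the correction `k ε * i.period` is zero; with inflection points it
removes the jumps, by multiples of `π`, that `∫ τ ds` can have under smooth variations. -/
def IsCritical (e : Ends) (i : Inflections) (l₁ l₂ l₃ : ℝ) (γ : ℝ → E3) (F₀ : FrenetFrame γ) :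
    Prop :=
  ∀ (c : ℝ → ℝ → E3) (F : ∀ ε, FrenetFrame (c ε)) (k : ℝ → ℤ),
    IsVariation e γ c →
    (∀ ε, FrenetFrame.Admissible e i F₀ (F ε)) →
    ContinuousAt (fun ε => (F ε).totalTorsion + k ε * i.period) 0 →
    HasDerivAt (fun ε => geometricFunctional l₁ l₂ l₃ (F ε) + l₂ * (k ε * i.period)) 0 0

/-! ### Rods -/

/-- `M` is the first material vector `M₁` of a rod with centerline `c`: a smooth unit normal field.
The material frame is the positively oriented orthonormal frame `(M₁, M₂, T)`, `M₂ = T × M₁`. -/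
structure IsMaterialFrame (c M : ℝ → E3) : Prop where
  smooth : ContDiff ℝ ∞ M
  norm_eq : ∀ t ∈ Icc (0 : ℝ) 1, ‖M t‖ = 1
  inner_eq : ∀ t ∈ Icc (0 : ℝ) 1, ⟪tangent c t, M t⟫ = 0

/-- The second material vector. -/
def material₂ (c M : ℝ → E3) (t : ℝ) : E3 := cross (tangent c t) (M t)

/-! The material strains are the components of the Darboux vector `u₁ M₁ + u₂ M₂ + u₃ T`, that is
`T' = u₂ M₁ - u₁ M₂`, `M₁' = -u₂ T + u₃ M₂`, `M₂' = u₁ T - u₃ M₁`. -/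

/-- The material strain `u₁`. -/
def strain₁ (c M : ℝ → E3) (t : ℝ) : ℝ := -⟪arcDeriv c (tangent c) t, material₂ c M t⟫

/-- The material strain `u₂`. -/
def strain₂ (c M : ℝ → E3) (t : ℝ) : ℝ := ⟪arcDeriv c (tangent c) t, M t⟫

/-- The twist rate `u₃`. -/
def strain₃ (c M : ℝ → E3) (t : ℝ) : ℝ := ⟪arcDeriv c M t, material₂ c M t⟫

/-- The elastic energy `∫ α (u₁² + u₂²) + β u₃² ds` of a rod. -/
def energy (α β : ℝ) (c M : ℝ → E3) : ℝ :=
  arcIntegral c fun t =>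
    α * (strain₁ c M t ^ 2 + strain₂ c M t ^ 2) + β * strain₃ c M t ^ 2

/-- `D = Δψ`, the total change of the angle `ψ` with `M₁ = N cos ψ + B sin ψ`. -/
def HasTotalTwist {c : ℝ → E3} (F : FrenetFrame c) (M : ℝ → E3) (D : ℝ) : Prop :=
  ∃ ψ : ℝ → ℝ, ContDiff ℝ ∞ ψ ∧
    (∀ t ∈ Icc (0 : ℝ) 1, M t = Real.cos (ψ t) • F.N t + Real.sin (ψ t) • F.B t) ∧
    ψ 1 - ψ 0 = D

/-- Smooth variations `(c ε, M ε)` of the rod `(γ, M₀)` through rods of the same length that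
satisfy the boundary conditions for the centerline and have the prescribed value `D` of `Δψ`
(modulo `π` if inflection points are allowed). -/
structure IsRodVariation (e : Ends) (i : Inflections) (γ : ℝ → E3) (F₀ : FrenetFrame γ)
    (M₀ : ℝ → E3) (D : ℝ) (c M : ℝ → ℝ → E3) : Prop where
  curve : IsVariation e γ c
  smooth : ContDiff ℝ ∞ fun p : ℝ × ℝ => M p.1 p.2
  start : M 0 = M₀
  frame : ∀ ε, IsMaterialFrame (c ε) (M ε)
  length_eq : ∀ ε, length (c ε) = length γ
  twist : ∀ ε, ∃ F : FrenetFrame (c ε), FrenetFrame.Admissible e i F₀ F ∧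
    ∃ k : ℤ, HasTotalTwist F (M ε) (D + k * i.period)

/-- The rod `(γ, M₀)` is an equilibrium for the elastic energy among rods of the same length with
the prescribed value `D` of `Δψ`. -/
def IsEquilibrium (e : Ends) (i : Inflections) (α β : ℝ) (γ : ℝ → E3) (F₀ : FrenetFrame γ)
    (M₀ : ℝ → E3) (D : ℝ) : Prop :=
  ∀ c M : ℝ → ℝ → E3, IsRodVariation e i γ F₀ M₀ D c M →
    HasDerivAt (fun ε => energy α β (c ε) (M ε)) 0 0

end ElasticRod

end

namespace ElasticRod

/-! ### Vector algebra in `ℝ³` -/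

/-! Expanding the twist energy about the constant `m`, `u₃² = (u₃ - m)² + 2 m u₃ - m²`, and using
the balance equation for `∫ u₃ ds`, the energy of any admissible rod becomes `α ∫ κ² + 2βm ∫ τ` plus
`β ∫ (u₃ - m)²` plus terms depending only on length and `Δψ` (`energy_eq`, `arcIntegral_strain₃`).
The condition on `m` makes the first two terms `α/λ₃` times the geometric functional, up to its
length term. Length and `Δψ` are prescribed, so `λ₁` plays no role.

If `u₃ ≡ m` at `ε = 0`, the square term is `O(ε²)`, and criticality of the centerline gives
equilibrium; no Euler–Lagrange equations are needed. Such a rod exists by solving `ψ' = m - τ`. -/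

theorem inner_eq_sum (x y : E3) : ⟪x, y⟫ = x 0 * y 0 + x 1 * y 1 + x 2 * y 2 := by
  simp [PiLp.inner_apply, Fin.sum_univ_three]
  ring

theorem cross_zero (x y : E3) : cross x y 0 = x 1 * y 2 - x 2 * y 1 := by
  simp [cross, crossProduct]

theorem cross_one (x y : E3) : cross x y 1 = x 2 * y 0 - x 0 * y 2 := by
  simp [cross, crossProduct]

theorem cross_two (x y : E3) : cross x y 2 = x 0 * y 1 - x 1 * y 0 := by
  simp [cross, crossProduct]

theorem inner_cross_left (x y : E3) : ⟪x, cross x y⟫ = 0 := by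
  rw [inner_eq_sum, cross_zero, cross_one, cross_two]; ring

theorem inner_cross_right (x y : E3) : ⟪y, cross x y⟫ = 0 := by
  rw [inner_eq_sum, cross_zero, cross_one, cross_two]; ring

theorem inner_cross_self (x y : E3) :
    ⟪cross x y, cross x y⟫ = ⟪x, x⟫ * ⟪y, y⟫ - ⟪x, y⟫ ^ 2 := by
  simp only [inner_eq_sum, cross_zero, cross_one, cross_two]; ring

theorem cross_cross_self (x y : E3) : cross x (cross x y) = ⟪x, y⟫ • x - ⟪x, x⟫ • y := by
  rw [inner_eq_sum, inner_eq_sum]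
  ext j
  fin_cases j <;> simp [cross_zero, cross_one, cross_two] <;> ring

theorem cross_add_smul (x y z : E3) (a b : ℝ) :
    cross x (a • y + b • z) = a • cross x y + b • cross x z := by
  simp [cross]

theorem contDiff_cross {E : Type*} [NormedAddCommGroup E] [NormedSpace ℝ E] {n : WithTop ℕ∞}
    {f g : E → E3} (hf : ContDiff ℝ n f) (hg : ContDiff ℝ n g) :
    ContDiff ℝ n fun p => cross (f p) (g p) := by
  have hf' := contDiff_euclidean.1 hf
  have hg' := contDiff_euclidean.1 hg
  rw [contDiff_euclidean]
  intro j
  fin_cases j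
  · simpa [cross_zero] using ((hf' 1).mul (hg' 2)).sub ((hf' 2).mul (hg' 1))
  · simpa [cross_one] using ((hf' 2).mul (hg' 0)).sub ((hf' 0).mul (hg' 2))
  · simpa [cross_two] using ((hf' 0).mul (hg' 1)).sub ((hf' 1).mul (hg' 0))

/-! ### Smoothness of the strains in a family of rods -/

theorem contDiff_deriv_param {f : ℝ → ℝ → E3} (hf : ContDiff ℝ ∞ fun p : ℝ × ℝ => f p.1 p.2) :
    ContDiff ℝ ∞ fun p : ℝ × ℝ => deriv (f p.1) p.2 := by
  have h : ContDiff ℝ ∞ fun p : ℝ × ℝ => fderiv ℝ (f p.1) p.2 (1 : ℝ) :=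
    ContDiff.fderiv_apply (f := fun p : ℝ × ℝ => f p.1) (n := ∞)
      (hf.comp ((contDiff_fst.comp contDiff_fst).prodMk contDiff_snd)) contDiff_snd
      contDiff_const (by simp)
  simpa using h


theorem contDiff_speed_param {c : ℝ → ℝ → E3} (hc : ContDiff ℝ ∞ fun p : ℝ × ℝ => c p.1 p.2)
    (hreg : ∀ ε t, deriv (c ε) t ≠ 0) : ContDiff ℝ ∞ fun p : ℝ × ℝ => speed (c p.1) p.2 :=
  (contDiff_deriv_param hc).norm ℝ fun p => hreg p.1 p.2

theorem speed_pos {c : ℝ → E3} {t : ℝ} (h : deriv c t ≠ 0) : 0 < speed c t :=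
  norm_pos_iff.2 h

theorem contDiff_arcDeriv_param {c f : ℝ → ℝ → E3}
    (hc : ContDiff ℝ ∞ fun p : ℝ × ℝ => c p.1 p.2) (hreg : ∀ ε t, deriv (c ε) t ≠ 0)
    (hf : ContDiff ℝ ∞ fun p : ℝ × ℝ => f p.1 p.2) :
    ContDiff ℝ ∞ fun p : ℝ × ℝ => arcDeriv (c p.1) (f p.1) p.2 :=
  ((contDiff_speed_param hc hreg).inv fun p => (speed_pos (hreg p.1 p.2)).ne').smul
    (contDiff_deriv_param hf)

theorem contDiff_strain₃_param {c M : ℝ → ℝ → E3}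
    (hc : ContDiff ℝ ∞ fun p : ℝ × ℝ => c p.1 p.2) (hreg : ∀ ε t, deriv (c ε) t ≠ 0)
    (hM : ContDiff ℝ ∞ fun p : ℝ × ℝ => M p.1 p.2) :
    ContDiff ℝ ∞ fun p : ℝ × ℝ => strain₃ (c p.1) (M p.1) p.2 :=
  (contDiff_arcDeriv_param hc hreg hM).inner ℝ
    (contDiff_cross (contDiff_arcDeriv_param hc hreg hc) hM)

theorem IsCurve.contDiff_speed {e : Ends} {c : ℝ → E3} (hc : IsCurve e c) :
    ContDiff ℝ ∞ (speed c) :=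
  (contDiff_infty_iff_deriv.1 hc.smooth).2.norm ℝ hc.regular

theorem IsCurve.norm_tangent {e : Ends} {c : ℝ → E3} (hc : IsCurve e c) (t : ℝ) :
    ‖tangent c t‖ = 1 := by
  have h := speed_pos (hc.regular t)
  rw [tangent, arcDeriv, norm_smul, norm_inv, Real.norm_of_nonneg h.le]
  exact inv_mul_cancel₀ h.ne'

/-! ### The material frame in terms of the Frenet frame -/

namespace FrenetFrame

variable {e : Ends} {c : ℝ → E3}

theorem inner_N_B (F : FrenetFrame c) {t : ℝ} (ht : t ∈ Icc (0 : ℝ) 1) :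
    ⟪F.N t, F.B t⟫ = 0 := by
  rw [F.B_eq t ht, inner_cross_right]

theorem inner_tangent_B (F : FrenetFrame c) {t : ℝ} (ht : t ∈ Icc (0 : ℝ) 1) :
    ⟪tangent c t, F.B t⟫ = 0 := by
  rw [F.B_eq t ht, inner_cross_left]

theorem inner_N_N (F : FrenetFrame c) {t : ℝ} (ht : t ∈ Icc (0 : ℝ) 1) :
    ⟪F.N t, F.N t⟫ = 1 := by
  rw [real_inner_self_eq_norm_sq, F.norm_N t ht, one_pow]

theorem inner_B_B (F : FrenetFrame c) (hc : IsCurve e c) {t : ℝ} (ht : t ∈ Icc (0 : ℝ) 1) :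
    ⟪F.B t, F.B t⟫ = 1 := by
  rw [F.B_eq t ht, inner_cross_self, F.inner_N t ht, F.inner_N_N ht, real_inner_self_eq_norm_sq,
    hc.norm_tangent]
  norm_num

theorem cross_tangent_B (F : FrenetFrame c) (hc : IsCurve e c) {t : ℝ}
    (ht : t ∈ Icc (0 : ℝ) 1) : cross (tangent c t) (F.B t) = -F.N t := by
  rw [F.B_eq t ht, cross_cross_self, F.inner_N t ht, real_inner_self_eq_norm_sq,
    hc.norm_tangent]
  simp

variable {M : ℝ → E3} {ψ : ℝ → ℝ}

theorem material₂_eq (F : FrenetFrame c) (hc : IsCurve e c) {t : ℝ} (ht : t ∈ Icc (0 : ℝ) 1)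
    (hM : M t = Real.cos (ψ t) • F.N t + Real.sin (ψ t) • F.B t) :
    material₂ c M t = Real.cos (ψ t) • F.B t - Real.sin (ψ t) • F.N t := by
  rw [material₂, hM, cross_add_smul, ← F.B_eq t ht, F.cross_tangent_B hc ht]
  module

/-- `(M₁, M₂)` is `(N, B)` rotated by `ψ`, so `T' = κ N` has components `κ cos ψ` and `-κ sin ψ` in
it. -/
theorem strain_sq_add_strain_sq (F : FrenetFrame c) (hc : IsCurve e c) {t : ℝ}
    (ht : t ∈ Icc (0 : ℝ) 1) (hM : M t = Real.cos (ψ t) • F.N t + Real.sin (ψ t) • F.B t) :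
    strain₁ c M t ^ 2 + strain₂ c M t ^ 2 = F.κ t ^ 2 := by
  rw [strain₁, strain₂, F.material₂_eq hc ht hM, hM, F.frenet_T t ht]
  simp only [inner_add_right, inner_sub_right, real_inner_smul_left, real_inner_smul_right,
    F.inner_N_N ht, F.inner_N_B ht]
  linear_combination F.κ t ^ 2 * Real.sin_sq_add_cos_sq (ψ t)

/-- Infinitesimal form of the balance equation, `u₃ ds = dψ + τ ds`: the frame `(N, B)` turns at
rate `τ`, and `M₁` turns relative to it at rate `ψ'`. -/
theorem strain₃_mul_speed (F : FrenetFrame c) (hc : IsCurve e c) (hψ : ContDiff ℝ ∞ ψ)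
    (hMs : ContDiff ℝ ∞ M)
    (hM : ∀ t ∈ Icc (0 : ℝ) 1, M t = Real.cos (ψ t) • F.N t + Real.sin (ψ t) • F.B t)
    {t : ℝ} (ht : t ∈ Icc (0 : ℝ) 1) :
    strain₃ c M t * speed c t = deriv ψ t + F.τ t * speed c t := by
  have hv := speed_pos (hc.regular t)
  have hψ' : HasDerivAt ψ (deriv ψ t) t := (hψ.differentiable (by simp) t).hasDerivAt
  have hN' : HasDerivAt F.N (speed c t • (-(F.κ t) • tangent c t + F.τ t • F.B t)) t := by
    rw [← F.frenet_N t ht, arcDeriv, smul_inv_smul₀ hv.ne']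
    exact (F.smooth_N.differentiable (by simp) t).hasDerivAt
  have hB' : HasDerivAt F.B (speed c t • (-(F.τ t) • F.N t)) t := by
    rw [← F.frenet_B t ht, arcDeriv, smul_inv_smul₀ hv.ne']
    exact (F.smooth_B.differentiable (by simp) t).hasDerivAt
  have hR := (hψ'.cos.smul hN').add (hψ'.sin.smul hB')
  have hM' : HasDerivAt M (deriv M t) t := (hMs.differentiable (by simp) t).hasDerivAt
  -- `M` is given by the angle only on `[0, 1]`, so at the endpoints only one-sided derivatives can
  -- be compared.
  have heq := (uniqueDiffOn_Icc (zero_lt_one' ℝ) t ht).eq_deriv _ hM'.hasDerivWithinAt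
    (hR.hasDerivWithinAt.congr hM (hM t ht))
  rw [strain₃, arcDeriv, F.material₂_eq hc ht (hM t ht), heq]
  have h1 := F.inner_N_B ht
  have h2 : ⟪F.B t, F.N t⟫ = 0 := by rw [real_inner_comm, h1]
  simp only [inner_add_left, inner_sub_right, real_inner_smul_left, real_inner_smul_right,
    F.inner_N_N ht, F.inner_B_B hc ht, F.inner_N t ht, F.inner_tangent_B ht, h1, h2]
  field_simp
  linear_combination (deriv ψ t + F.τ t * speed c t) * Real.sin_sq_add_cos_sq (ψ t)

end FrenetFrame

theorem intervalIntegral_congr_Icc {f g : ℝ → ℝ} (h : ∀ t ∈ Icc (0 : ℝ) 1, f t = g t) :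
    ∫ t in (0 : ℝ)..1, f t = ∫ t in (0 : ℝ)..1, g t :=
  intervalIntegral.integral_congr fun t ht => h t (by simpa using ht)

/-- The balance equation `∫ u₃ ds = Δψ + ∫ τ ds`. -/
theorem arcIntegral_strain₃ {e : Ends} {c M : ℝ → E3} (hc : IsCurve e c) (F : FrenetFrame c)
    (hM : ContDiff ℝ ∞ M) {D : ℝ} (hD : HasTotalTwist F M D) :
    arcIntegral c (strain₃ c M) = D + F.totalTorsion := by
  obtain ⟨ψ, hψ, hMψ, rfl⟩ := hD
  have hψ' : Continuous (deriv ψ) := hψ.continuous_deriv (by simp)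
  have hτ : Continuous fun t => F.τ t * speed c t :=
    F.smooth_τ.continuous.mul hc.contDiff_speed.continuous
  rw [arcIntegral, FrenetFrame.totalTorsion, arcIntegral,
    intervalIntegral_congr_Icc fun t ht => F.strain₃_mul_speed hc hψ hM hMψ ht,
    intervalIntegral.integral_add (hψ'.intervalIntegrable _ _) (hτ.intervalIntegrable _ _),
    intervalIntegral.integral_deriv_eq_sub (fun t _ => hψ.differentiable (by simp) t)
      (hψ'.intervalIntegrable _ _)]

/-- The energy of a rod, with the twist energy expanded about a constant twist rate `m`. -/
theorem energy_eq {e : Ends} {c M : ℝ → E3} (hc : IsCurve e c) (F : FrenetFrame c)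
    (hM : ContDiff ℝ ∞ M) {D : ℝ} (hD : HasTotalTwist F M D) (α β m : ℝ) :
    energy α β c M = α * F.bending + β * arcIntegral c (fun t => (strain₃ c M t - m) ^ 2) +
      2 * β * m * arcIntegral c (strain₃ c M) - β * m ^ 2 * length c := by
  obtain ⟨ψ, hψ, hMψ, rfl⟩ := hD
  have hv : Continuous (speed c) := hc.contDiff_speed.continuous
  have hu : Continuous (strain₃ c M) :=
    -- The single rod is treated as a constant family.
    ((contDiff_strain₃_param (c := fun _ => c) (M := fun _ => M) (hc.smooth.comp contDiff_snd)
      (fun _ => hc.regular) (hM.comp contDiff_snd)).comp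
        (contDiff_prodMk_right (0 : ℝ))).continuous
  have hκ : Continuous F.κ := F.smooth_κ.continuous
  have h1 : Continuous fun t => α * (F.κ t ^ 2 * speed c t) := by fun_prop
  have h2 : Continuous fun t => β * ((strain₃ c M t - m) ^ 2 * speed c t) := by fun_prop
  have h3 : Continuous fun t => 2 * β * m * (strain₃ c M t * speed c t) := by fun_prop
  have h4 : Continuous fun t => β * m ^ 2 * (1 * speed c t) := by fun_prop
  have h12 : Continuous fun t =>
      α * (F.κ t ^ 2 * speed c t) + β * ((strain₃ c M t - m) ^ 2 * speed c t) := h1.add h2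
  have h123 : Continuous fun t =>
      α * (F.κ t ^ 2 * speed c t) + β * ((strain₃ c M t - m) ^ 2 * speed c t) +
        2 * β * m * (strain₃ c M t * speed c t) := h12.add h3
  simp only [energy, FrenetFrame.bending, length, arcIntegral]
  rw [← intervalIntegral.integral_const_mul, ← intervalIntegral.integral_const_mul,
    ← intervalIntegral.integral_const_mul, ← intervalIntegral.integral_const_mul,
    ← intervalIntegral.integral_add (h1.intervalIntegrable _ _) (h2.intervalIntegrable _ _),
    ← intervalIntegral.integral_add (h12.intervalIntegrable _ _) (h3.intervalIntegrable _ _),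
    ← intervalIntegral.integral_sub (h123.intervalIntegrable _ _) (h4.intervalIntegrable _ _)]
  refine intervalIntegral_congr_Icc fun t ht => ?_
  rw [F.strain_sq_add_strain_sq hc ht (hMψ t ht)]
  ring

/-! ### Equilibria -/

/-- The mean value inequality on a compact rectangle gives `|h (ε, t)| ≤ L |ε|`, so the integral is
`O(ε²)`. Differentiation under the integral sign is avoided. -/
theorem hasDerivAt_integral_sq_mul_zero {h v : ℝ × ℝ → ℝ} (hh : ContDiff ℝ 1 h)
    (hv : Continuous v) (h0 : ∀ t ∈ Icc (0 : ℝ) 1, h (0, t) = 0) :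
    HasDerivAt (fun ε => ∫ t in (0 : ℝ)..1, h (ε, t) ^ 2 * v (ε, t)) 0 0 := by
  have hK : IsCompact (Icc (-1 : ℝ) 1 ×ˢ Icc (0 : ℝ) 1) := isCompact_Icc.prod isCompact_Icc
  have hconv : Convex ℝ (Icc (-1 : ℝ) 1 ×ˢ Icc (0 : ℝ) 1) :=
    (convex_Icc _ _).prod (convex_Icc _ _)
  obtain ⟨V, hV⟩ := hK.exists_bound_of_continuousOn hv.continuousOn
  obtain ⟨L, hL⟩ := hK.exists_bound_of_continuousOn
    (hh.continuous_fderiv (by simp)).continuousOn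
  have hbound : ∀ ε ∈ Icc (-1 : ℝ) 1, ∀ t ∈ Icc (0 : ℝ) 1, |h (ε, t)| ≤ L * |ε| := by
    intro ε hε t ht
    have := hconv.norm_image_sub_le_of_norm_fderiv_le
      (fun x _ => hh.differentiable (by simp) x) hL
      (x := (0, t)) (y := (ε, t)) ⟨by simp, ht⟩ ⟨hε, ht⟩
    simpa [h0 t ht, Prod.norm_def] using this
  have hO : (fun ε => ∫ t in (0 : ℝ)..1, h (ε, t) ^ 2 * v (ε, t)) =O[nhds 0]
      fun ε : ℝ => ε ^ 2 := by
    refine Asymptotics.IsBigO.of_bound (L ^ 2 * V) ?_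
    filter_upwards [Icc_mem_nhds (by norm_num : (-1 : ℝ) < 0) one_pos] with ε hε
    have hint : ∀ t ∈ uIoc (0 : ℝ) 1, ‖h (ε, t) ^ 2 * v (ε, t)‖ ≤ L ^ 2 * V * ‖ε ^ 2‖ := by
      intro t ht
      rw [uIoc_of_le zero_le_one] at ht
      have ht' := Ioc_subset_Icc_self ht
      calc ‖h (ε, t) ^ 2 * v (ε, t)‖ = |h (ε, t)| ^ 2 * ‖v (ε, t)‖ := by
            rw [norm_mul, norm_pow, Real.norm_eq_abs (h (ε, t))]
        _ ≤ (L * |ε|) ^ 2 * V := by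
            gcongr
            · exact hbound ε hε t ht'
            · exact hV _ ⟨hε, ht'⟩
        _ = L ^ 2 * V * ‖ε ^ 2‖ := by rw [norm_pow, Real.norm_eq_abs]; ring
    simpa using intervalIntegral.norm_integral_le_of_norm_le_const hint
  have hz : ∫ t in (0 : ℝ)..1, h (0, t) ^ 2 * v (0, t) = 0 := by
    rw [intervalIntegral_congr_Icc (g := fun _ => 0) fun t ht => by simp [h0 t ht]]
    simp
  rw [hasDerivAt_iff_isLittleO]
  simp only [hz, sub_zero, smul_zero]
  exact hO.trans_isLittleO (Asymptotics.isLittleO_pow_id one_lt_two)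

theorem isEquilibrium_of_isCritical {e : Ends} {i : Inflections} {α β l₁ l₂ l₃ m D : ℝ}
    (hl₃ : l₃ ≠ 0) {γ M₀ : ℝ → E3} {F₀ : FrenetFrame γ}
    (hcrit : IsCritical e i l₁ l₂ l₃ γ F₀) (hm : α * l₂ = 2 * β * m * l₃)
    (hM₀ : ∀ t ∈ Icc (0 : ℝ) 1, strain₃ γ M₀ t = m) :
    IsEquilibrium e i α β γ F₀ M₀ D := by
  intro c M h
  choose F hF k hk using h.twist
  have hreg : ∀ ε t, deriv (c ε) t ≠ 0 := fun ε => (h.curve.curve ε).regular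
  have hu := contDiff_strain₃_param h.curve.smooth hreg h.smooth
  have hv := contDiff_speed_param h.curve.smooth hreg
  -- The Frenet frames and the integers `k ε` are chosen separately for each `ε`, so each summand
  -- may jump. Their sum is `∫ u₃ ds - D`, which depends continuously on `ε`; this is the branch
  -- that criticality requires.
  have hbal : ∀ ε, (F ε).totalTorsion + k ε * i.period =
      arcIntegral (c ε) (strain₃ (c ε) (M ε)) - D := fun ε => by
    rw [arcIntegral_strain₃ (h.curve.curve ε) (F ε) (h.frame ε).smooth (hk ε)]
    ring
  have hcont : Continuous fun ε => (F ε).totalTorsion + k ε * i.period := by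
    simp only [hbal]
    exact (intervalIntegral.continuous_parametric_intervalIntegral_of_continuous'
      (f := fun ε t => strain₃ (c ε) (M ε) t * speed (c ε) t)
      (hu.continuous.mul hv.continuous) 0 1).sub continuous_const
  have hG := hcrit c F k h.curve hF hcont.continuousAt
  have hS := hasDerivAt_integral_sq_mul_zero
    (h := fun p => strain₃ (c p.1) (M p.1) p.2 - m) (v := fun p => speed (c p.1) p.2)
    ((hu.sub contDiff_const).of_le (by simp)) hv.continuous fun t ht => by
      simp [h.curve.start, h.start, hM₀ t ht]
  -- The added constant collects the terms of the energy fixed by the prescribed twist and length,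
  -- and cancels the `l₁` contribution.
  have hE := ((hG.const_mul (α / l₃)).add (hS.const_mul β)).add_const
    (2 * β * m * D - (α / l₃ * l₁ + β * m ^ 2) * length γ)
  simp only [mul_zero, add_zero] at hE
  refine hE.congr_of_eventuallyEq (Filter.Eventually.of_forall fun ε => ?_)
  have hb := hbal ε
  have hα : α / l₃ * l₂ = 2 * β * m := by field_simp; linarith
  have hα' : α / l₃ * l₃ = α := div_mul_cancel₀ α hl₃
  simp only [energy_eq (h.curve.curve ε) (F ε) (h.frame ε).smooth (hk ε) α β m,
    geometricFunctional, h.length_eq ε, Pi.add_apply]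
  rw [eq_add_of_sub_eq hb.symm]
  simp only [arcIntegral]
  linear_combination (-(F ε).totalTorsion - k ε * i.period) * hα - (F ε).bending * hα'

/-- Every curve with a generalized Frenet frame is the centerline of a rod of constant twist
rate `m`. -/
theorem exists_constant_twist_rate {e : Ends} {γ : ℝ → E3} (hγ : IsCurve e γ)
    (F : FrenetFrame γ) (m : ℝ) :
    ∃ (M : ℝ → E3) (D : ℝ), IsMaterialFrame γ M ∧
      (∀ t ∈ Icc (0 : ℝ) 1, strain₃ γ M t = m) ∧ HasTotalTwist F M D := by
  have hg : ContDiff ℝ ∞ fun t => (m - F.τ t) * speed γ t :=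
    (contDiff_const.sub F.smooth_τ).mul hγ.contDiff_speed
  -- By `u₃ = dψ/ds + τ`, twist rate `m` requires `ψ` to be a primitive of `(m - τ) ds`.
  obtain ⟨ψ, hψ'⟩ : ∃ ψ : ℝ → ℝ, ∀ t, HasDerivAt ψ ((m - F.τ t) * speed γ t) t :=
    ⟨fun t => ∫ s in (0 : ℝ)..t, (m - F.τ s) * speed γ s,
      fun t => hg.continuous.integral_hasStrictDerivAt 0 t |>.hasDerivAt⟩
  have hψ : ContDiff ℝ ∞ ψ := by
    rw [contDiff_infty_iff_deriv]
    exact ⟨fun t => (hψ' t).differentiableAt, by rwa [funext fun t => (hψ' t).deriv]⟩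
  have hMs : ContDiff ℝ ∞ fun t => Real.cos (ψ t) • F.N t + Real.sin (ψ t) • F.B t :=
    (hψ.cos.smul F.smooth_N).add (hψ.sin.smul F.smooth_B)
  refine ⟨fun t => Real.cos (ψ t) • F.N t + Real.sin (ψ t) • F.B t, ψ 1 - ψ 0,
    ⟨hMs, fun t ht => ?_, fun t ht => ?_⟩, fun t ht => ?_, ψ, hψ, fun _ _ => rfl, rfl⟩
  · have h1 := F.inner_N_B ht
    have h2 : ⟪F.B t, F.N t⟫ = 0 := by rw [real_inner_comm, h1]
    rw [← sq_eq_sq₀ (norm_nonneg _) zero_le_one, ← real_inner_self_eq_norm_sq]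
    simp only [inner_add_left, inner_add_right, real_inner_smul_left, real_inner_smul_right,
      F.inner_N_N ht, F.inner_B_B hγ ht, h1, h2]
    linear_combination Real.sin_sq_add_cos_sq (ψ t)
  · simp only [inner_add_right, real_inner_smul_right, F.inner_N t ht, F.inner_tangent_B ht]
    ring
  · have h := F.strain₃_mul_speed hγ hψ hMs (fun _ _ => rfl) ht
    rw [(hψ' t).deriv] at h
    refine mul_right_cancel₀ (speed_pos (hγ.regular t)).ne' (h.trans ?_)
    ring

end ElasticRod

theorem mainTheorem6 (e : ElasticRod.Ends) (i : ElasticRod.Inflections)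
    (α β : ℝ) (hα : 0 < α) (hβ : 0 < β)
    (l₁ l₂ l₃ : ℝ) (hl₃ : l₃ ≠ 0)
    (γ : ℝ → ElasticRod.E3) (hγ : ElasticRod.IsCurve e γ)
    (F : ElasticRod.FrenetFrame γ) (hF : ElasticRod.FrenetFrame.Admissible e i F F)
    (hcrit : ElasticRod.IsCritical e i l₁ l₂ l₃ γ F) :
    (∃! m : ℝ, α * l₂ = (2 * β * m) * l₃) ∧
    ∀ m : ℝ, α * l₂ = (2 * β * m) * l₃ →
      ∃ (M : ℝ → ElasticRod.E3) (D : ℝ),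
        ElasticRod.IsMaterialFrame γ M ∧
        (∀ t ∈ Set.Icc (0 : ℝ) 1, ElasticRod.strain₃ γ M t = m) ∧
        ElasticRod.HasTotalTwist F M D ∧
        ElasticRod.arcIntegral γ (ElasticRod.strain₃ γ M) = D + F.totalTorsion ∧
        ElasticRod.IsEquilibrium e i α β γ F M D := by
  refine ⟨⟨α * l₂ / (2 * β * l₃), by field_simp, fun m hm => ?_⟩, fun m hm => ?_⟩
  · rw [eq_div_iff (by positivity)]
    linear_combination -hm
  · obtain ⟨M, D, hM, hu, hD⟩ := ElasticRod.exists_constant_twist_rate hγ F m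
    exact ⟨M, D, hM, hu, hD, ElasticRod.arcIntegral_strain₃ hγ F hM.smooth hD,
      ElasticRod.isEquilibrium_of_isCritical hl₃ hcrit hm hu⟩
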